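/- Let $\mathcal H$ be a complex Hilbert space, let $T$ be a Jordan operator on $\mathcal H$, i.e. $T=M+N$ with $M,N$ bounded linear operators on $\mathcal H$, $M$ normal, $N$ nilpotent and $MN=NM$, and let $h\in\mathcal H$. Let $\Lambda_{T,h}$ be the linear functional on $\mathbb C[z,\bar z]$ determined by $$\Lambda_{T,h}(z^k\bar z^l)=\langle T^kh,T^lh\rangle_{\mathcal H},\qquad k,l\in\mathbb N_0$$ (the inner product being linear in the first variable). Then $\Lambda_{T,h}$ is a compactly supported distribution supported in the closed convex hull $K$ of the spectrum $\sigma(M)$. That is, there is a continuous linear functional $u$ on the Fréchet space $\mathscr C^\infty(\mathbb C)$ of smooth functions $\mathbb C=\mathbb R^2\to\mathbb C$ (with the topology of uniform convergence of all derivatives on compact sets) such that $u(p)=\Lambda_{T,h}(p)$ for all $p\in\mathbb C[z,\bar z]$ and $\operatorname{supp}u\subseteq K$. -/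

import Mathlib

open scoped ContDiff

noncomputable section

/-- The complex vector space of all smooth (real sense) functions `ℂ → ℂ`, where `ℂ = ℝ²`. -/
def smoothSubmodule : Submodule ℂ (ℂ → ℂ) where
  carrier := {f | ContDiff ℝ ∞ f}
  add_mem' hf hg := Set.mem_ofPred.2 ((Set.mem_ofPred.1 hf).add (Set.mem_ofPred.1 hg))
  zero_mem' := Set.mem_ofPred.2 contDiff_const
  smul_mem' c _ hf := Set.mem_ofPred.2 ((Set.mem_ofPred.1 hf).const_smul c)

/-- `𝒞^∞(ℂ)` as a type of its own, to carry the Fréchet topology below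
(and not the topology of pointwise convergence). -/
def SmoothFunction : Type := smoothSubmodule

namespace SmoothFunction

instance : AddCommGroup SmoothFunction := inferInstanceAs (AddCommGroup smoothSubmodule)

instance : Module ℂ SmoothFunction := inferInstanceAs (Module ℂ smoothSubmodule)

instance : FunLike SmoothFunction ℂ ℂ where
  coe f := f.1
  coe_injective _ _ h := Subtype.ext h

theorem contDiff (f : SmoothFunction) : ContDiff ℝ ∞ f := f.2

theorem contDiffAt (f : SmoothFunction) (n : ℕ) (x : ℂ) : ContDiffAt ℝ n f x :=
  (f.contDiff.of_le (by exact_mod_cast le_top)).contDiffAt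

theorem coe_add (f g : SmoothFunction) : ⇑(f + g) = ⇑f + ⇑g := rfl

theorem coe_smul (c : ℂ) (f : SmoothFunction) : ⇑(c • f) = c • ⇑f := rfl

/-- The `n`-th derivative of a smooth function, restricted to a compact set. -/
def derivOn (n : ℕ) (K : TopologicalSpace.Compacts ℂ) :
    SmoothFunction →ₗ[ℂ] C(K, ContinuousMultilinearMap ℝ (fun _ : Fin n => ℂ) ℂ) where
  toFun f :=
    { toFun := fun x => iteratedFDeriv ℝ n f x
      continuous_toFun :=
        (f.contDiff.continuous_iteratedFDeriv (by exact_mod_cast le_top)).comp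
          continuous_subtype_val }
  map_add' f g := by
    ext1 x
    exact iteratedFDeriv_add_apply (f.contDiffAt n x) (g.contDiffAt n x)
  map_smul' c f := by
    ext1 x
    exact iteratedFDeriv_const_smul_apply (f.contDiffAt n x)

/-- The seminorm `max {‖D^n f(x)‖ : n ≤ N, x ∈ K}` on `𝒞^∞(ℂ)`. -/
def smoothSeminorm : SeminormFamily ℂ SmoothFunction (ℕ × TopologicalSpace.Compacts ℂ) :=
  fun NK => (Finset.range (NK.1 + 1)).sup fun n =>
    (normSeminorm ℂ C(NK.2, ContinuousMultilinearMap ℝ (fun _ : Fin n => ℂ) ℂ)).comp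
      (derivOn n NK.2)

/-- The Fréchet topology of `𝒞^∞(ℂ)`, generated by the seminorms above. A compactly supported
distribution on `ℂ` is a continuous linear functional `SmoothFunction →L[ℂ] ℂ`. -/
instance : TopologicalSpace SmoothFunction := smoothSeminorm.moduleFilterBasis.topology

theorem withSeminorms : WithSeminorms smoothSeminorm := ⟨rfl⟩

end SmoothFunction

/-- The function `z ↦ p(z, z̄)` on `ℂ` is smooth; the variables `X 0`, `X 1` of `p` stand for
`z` and `z̄`. -/
theorem contDiff_evalConj (p : MvPolynomial (Fin 2) ℂ) :
    ContDiff ℝ ∞ fun z : ℂ => MvPolynomial.eval ![z, starRingEnd ℂ z] p := by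
  have h : ∀ i : Fin 2, ContDiff ℝ ∞ fun z : ℂ => (![z, starRingEnd ℂ z] : Fin 2 → ℂ) i := by
    intro i
    fin_cases i
    · exact contDiff_id
    · exact Complex.conjCLE.contDiff
  induction p using MvPolynomial.induction_on with
  | C a => simpa using contDiff_const
  | add p q hp hq => simpa using hp.add hq
  | mul_X p i hp => simpa using hp.mul (h i)

/-- The inclusion `ℂ[z, z̄] → 𝒞^∞(ℂ)`. -/
def polySmooth (p : MvPolynomial (Fin 2) ℂ) : SmoothFunction :=
  ⟨fun z => MvPolynomial.eval ![z, starRingEnd ℂ z] p, contDiff_evalConj p⟩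

section Agler

variable {H : Type*} [NormedAddCommGroup H] [InnerProductSpace ℂ H]

/-- The linear functional `Λ_{T,h}` on `ℂ[z, z̄]` with `Λ_{T,h}(z^k z̄^l) = ⟨T^k h, T^l h⟩`.
Mathlib's inner product is linear in the second variable, hence the order of the arguments. -/
def aglerFunctional (T : H →L[ℂ] H) (h : H) : MvPolynomial (Fin 2) ℂ →ₗ[ℂ] ℂ :=
  (MvPolynomial.basisMonomials (Fin 2) ℂ).constr ℂ
    fun α => inner ℂ ((T ^ α 1) h) ((T ^ α 0) h)

theorem aglerFunctional_X_pow_mul (T : H →L[ℂ] H) (h : H) (k l : ℕ) :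
    aglerFunctional T h (MvPolynomial.X 0 ^ k * MvPolynomial.X 1 ^ l) =
      inner ℂ ((T ^ l) h) ((T ^ k) h) := by
  have e : (MvPolynomial.X 0 ^ k * MvPolynomial.X 1 ^ l : MvPolynomial (Fin 2) ℂ) =
      MvPolynomial.basisMonomials (Fin 2) ℂ
        (Finsupp.single 0 k + Finsupp.single 1 l) := by
    simp [MvPolynomial.X_pow_eq_monomial, MvPolynomial.monomial_mul]
  rw [e, aglerFunctional, Module.Basis.constr_basis]
  simp

end Agler

/-- The linear functional `L` on `ℂ[z, z̄]` is a (compactly supported) distribution with support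
in `K`: it is the restriction to `ℂ[z, z̄]` of a continuous linear functional on `𝒞^∞(ℂ)` whose
support is contained in `K`. -/
def IsDistributionSupportedIn (L : MvPolynomial (Fin 2) ℂ →ₗ[ℂ] ℂ) (K : Set ℂ) : Prop :=
  ∃ u : SmoothFunction →L[ℂ] ℂ,
    (∀ p, L p = u (polySmooth p)) ∧ Distribution.dsupport u ⊆ K

/-- `T = M + N` exhibits `T` as a Jordan operator: `M` is normal, `N` is nilpotent and
`MN = NM`. -/
structure IsJordanDecomposition {H : Type*} [NormedAddCommGroup H] [InnerProductSpace ℂ H]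
    [CompleteSpace H] (T M N : H →L[ℂ] H) : Prop where
  eq_add : T = M + N
  normal : IsStarNormal M
  nilpotent : IsNilpotent N
  commute : M * N = N * M

end

namespace SmoothFunction

/-! The distribution is a Taylor expansion in the nilpotent part. Expanding both powers of `M + N`
binomially writes `⟨T^k h, T^l h⟩` as a sum of terms `⟨M*^(l-j) M^(k-i) N^i h, N^j h⟩` with binomial
weights. By the functional calculus, such a weighted term is the matrix coefficient of `∂^i ∂̄^j
(z^k z̄^l) / (i! j!)` evaluated at `M`. All powers of `N` act on `h`, so `N` never has to be moved
past `M*`. Since `N ^ n = 0`, only `i, j < n` occur, and the formula makes sense for every smooth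
function. It uses finitely many derivatives on the compact set `σ(M)`, so it is continuous and
supported in `σ(M)`, hence in the hull. The key lemmas are `jordanDistribution_monomial` and
`dsupport_jordanDistribution_subset`. -/

theorem coe_continuous (f : SmoothFunction) : Continuous f := f.contDiff.continuous

theorem norm_iteratedFDeriv_le_smoothSeminorm (f : SmoothFunction) {n N : ℕ} (hn : n ≤ N)
    {K : TopologicalSpace.Compacts ℂ} {x : ℂ} (hx : x ∈ K) :
    ‖iteratedFDeriv ℝ n f x‖ ≤ smoothSeminorm (N, K) f :=
  (ContinuousMap.norm_coe_le_norm (derivOn n K f) ⟨x, hx⟩).trans <|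
    Seminorm.le_finset_sup_apply
      (p := fun n => (normSeminorm ℂ
        C(K, ContinuousMultilinearMap ℝ (fun _ : Fin n => ℂ) ℂ)).comp (derivOn n K))
      (Finset.mem_range.2 (Nat.lt_succ_of_le hn))

theorem norm_le_smoothSeminorm (f : SmoothFunction) {K : TopologicalSpace.Compacts ℂ} {x : ℂ}
    (hx : x ∈ K) : ‖f x‖ ≤ smoothSeminorm (0, K) f := by
  simpa using f.norm_iteratedFDeriv_le_smoothSeminorm (le_refl 0) hx

theorem smoothSeminorm_le {f : SmoothFunction} {N : ℕ} {K : TopologicalSpace.Compacts ℂ} {C : ℝ}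
    (hC : 0 ≤ C) (h : ∀ n ≤ N, ∀ x ∈ K, ‖iteratedFDeriv ℝ n f x‖ ≤ C) :
    smoothSeminorm (N, K) f ≤ C :=
  Seminorm.finset_sup_apply_le hC fun n hn =>
    (ContinuousMap.norm_le _ hC).2 fun x =>
      h n (Nat.le_of_lt_succ (Finset.mem_range.1 hn)) x x.2

instance : IsTopologicalAddGroup SmoothFunction := withSeminorms.topologicalAddGroup

instance : ContinuousSMul ℂ SmoothFunction := withSeminorms.continuousSMul

theorem contDiff_fderiv (f : SmoothFunction) : ContDiff ℝ ∞ (fderiv ℝ f) :=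
  f.contDiff.fderiv_right (by simp)

theorem differentiableAt (f : SmoothFunction) (z : ℂ) : DifferentiableAt ℝ f z :=
  f.contDiff.differentiable (by simp) z

/-- The derivative of a smooth function in the direction `v`, as a linear map. -/
noncomputable def dirDerivₗ (v : ℂ) : SmoothFunction →ₗ[ℂ] SmoothFunction where
  toFun f := ⟨fun z => fderiv ℝ f z v, f.contDiff_fderiv.clm_apply contDiff_const⟩
  map_add' f g := by
    refine DFunLike.ext _ _ fun z => ?_
    change fderiv ℝ (⇑f + ⇑g) z v = fderiv ℝ f z v + fderiv ℝ g z v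
    rw [fderiv_add (f.differentiableAt z) (g.differentiableAt z)]
    rfl
  map_smul' c f := by
    refine DFunLike.ext _ _ fun z => ?_
    change fderiv ℝ (c • ⇑f) z v = c • fderiv ℝ f z v
    rw [fderiv_const_smul (f.differentiableAt z)]
    rfl

theorem continuous_dirDerivₗ (v : ℂ) : Continuous (dirDerivₗ v) := by
  refine withSeminorms.continuous_of_isBounded withSeminorms _ fun NK => ?_
  obtain ⟨N, K⟩ := NK
  -- Differentiating costs one order, on the same compact set.
  refine ⟨{(N + 1, K)}, ‖v‖₊, fun f => ?_⟩
  rw [Finset.sup_singleton, Seminorm.comp_apply, smul_apply, NNReal.smul_def,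
    smul_eq_mul, coe_nnnorm]
  refine smoothSeminorm_le (mul_nonneg (norm_nonneg _) (apply_nonneg _ _)) fun n hn x hx => ?_
  calc ‖iteratedFDeriv ℝ n (dirDerivₗ v f) x‖
      ≤ ‖v‖ * ‖iteratedFDeriv ℝ n (fderiv ℝ f) x‖ :=
        norm_iteratedFDeriv_clm_apply_const f.contDiff_fderiv.contDiffAt
          (by exact_mod_cast le_top)
    _ ≤ ‖v‖ * smoothSeminorm (N + 1, K) f := by
        rw [norm_iteratedFDeriv_fderiv]
        gcongr
        exact f.norm_iteratedFDeriv_le_smoothSeminorm (Nat.succ_le_succ hn) hx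

/-- The derivative of a smooth function in the direction `v`. -/
noncomputable def dirDeriv (v : ℂ) : SmoothFunction →L[ℂ] SmoothFunction :=
  ⟨dirDerivₗ v, continuous_dirDerivₗ v⟩

/-- The operator `(∂ₓ + c ∂_y) / 2`. The Wirtinger derivatives `∂` and `∂̄` are the cases
`c = -i` and `c = i`. -/
noncomputable def wirtinger (c : ℂ) : SmoothFunction →L[ℂ] SmoothFunction :=
  (1 / 2 : ℂ) • (dirDeriv 1 + c • dirDeriv Complex.I)

theorem wirtinger_apply (c : ℂ) (f : SmoothFunction) (z : ℂ) :
    wirtinger c f z = 1 / 2 * (fderiv ℝ f z 1 + c * fderiv ℝ f z Complex.I) := rfl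

theorem wirtinger_eventuallyEq_zero (c : ℂ) {f : SmoothFunction} {z : ℂ} (hf : f =ᶠ[nhds z] 0) :
    wirtinger c f =ᶠ[nhds z] 0 := by
  filter_upwards [hf.eventuallyEq_nhds] with w hw
  simp [wirtinger_apply, hw.fderiv_eq]

theorem wirtinger_pow_eventuallyEq_zero (c : ℂ) (n : ℕ) {f : SmoothFunction} {z : ℂ}
    (hf : f =ᶠ[nhds z] 0) : (wirtinger c ^ n) f =ᶠ[nhds z] 0 := by
  induction n with
  | zero => simpa using hf
  | succ n ih =>
    rw [pow_succ']
    exact wirtinger_eventuallyEq_zero c ih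

/-- The monomial `z ^ k * z̄ ^ l`. -/
noncomputable def monomial (k l : ℕ) : SmoothFunction :=
  polySmooth (MvPolynomial.X 0 ^ k * MvPolynomial.X 1 ^ l)

theorem coe_monomial (k l : ℕ) :
    ⇑(monomial k l) = fun z => z ^ k * (starRingEnd ℂ z) ^ l := by
  funext z
  change MvPolynomial.eval _ _ = _
  simp

theorem monomial_apply (k l : ℕ) (z : ℂ) :
    monomial k l z = z ^ k * (starRingEnd ℂ z) ^ l := by
  rw [coe_monomial]

theorem fderiv_monomial (k l : ℕ) (z v : ℂ) :
    fderiv ℝ (monomial k l) z v =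
      k * monomial (k - 1) l z * v + l * monomial k (l - 1) z * starRingEnd ℂ v := by
  have h1 : HasFDerivAt (fun z : ℂ => z) (ContinuousLinearMap.id ℝ ℂ) z := hasFDerivAt_id z
  have h2 : HasFDerivAt (fun z : ℂ => starRingEnd ℂ z) (Complex.conjCLE : ℂ →L[ℝ] ℂ) z :=
    Complex.conjCLE.hasFDerivAt
  have h3 : HasFDerivAt (fun z : ℂ => z ^ k * (starRingEnd ℂ z) ^ l) _ z :=
    (h1.pow k).mul (h2.pow l)
  rw [coe_monomial, h3.fderiv, monomial_apply, monomial_apply]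
  simp
  ring

/-- With `c = -i`, the `z̄`-part has factor `1 + c * conj i = 0` and the `z`-part has `1 + c * i =
2`. At `k = 0` the truncated exponent is harmless, since the coefficient is zero. -/
theorem wirtinger_neg_I_monomial (k l : ℕ) :
    wirtinger (-Complex.I) (monomial k l) = (k : ℂ) • monomial (k - 1) l := by
  refine DFunLike.ext _ _ fun z => ?_
  rw [wirtinger_apply, fderiv_monomial, fderiv_monomial, coe_smul, Pi.smul_apply, smul_eq_mul,
    map_one, Complex.conj_I]
  linear_combination (1 / 2 : ℂ) * (l * monomial k (l - 1) z - k * monomial (k - 1) l z) *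
    Complex.I_mul_I

theorem wirtinger_I_monomial (k l : ℕ) :
    wirtinger Complex.I (monomial k l) = (l : ℂ) • monomial k (l - 1) := by
  refine DFunLike.ext _ _ fun z => ?_
  rw [wirtinger_apply, fderiv_monomial, fderiv_monomial, coe_smul, Pi.smul_apply, smul_eq_mul,
    map_one, Complex.conj_I]
  linear_combination (1 / 2 : ℂ) * (k * monomial (k - 1) l z - l * monomial k (l - 1) z) *
    Complex.I_mul_I

theorem wirtinger_neg_I_pow_monomial (i k l : ℕ) :
    (wirtinger (-Complex.I) ^ i) (monomial k l) = (k.descFactorial i : ℂ) • monomial (k - i) l := by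
  induction i with
  | zero => simp
  | succ i ih =>
    rw [pow_succ', mul_apply_eq_comp, ih, map_smul, wirtinger_neg_I_monomial, smul_smul,
      Nat.descFactorial_succ, Nat.sub_sub]
    push_cast
    rw [mul_comm]

theorem wirtinger_I_pow_monomial (j k l : ℕ) :
    (wirtinger Complex.I ^ j) (monomial k l) = (l.descFactorial j : ℂ) • monomial k (l - j) := by
  induction j with
  | zero => simp
  | succ j ih =>
    rw [pow_succ', mul_apply_eq_comp, ih, map_smul, wirtinger_I_monomial, smul_smul,
      Nat.descFactorial_succ, Nat.sub_sub]
    push_cast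
    rw [mul_comm]

end SmoothFunction

/-! ### Functional calculus and the distribution of a Jordan operator -/

section Jordan

open SmoothFunction

variable {H : Type*} [NormedAddCommGroup H] [InnerProductSpace ℂ H] [CompleteSpace H]

/-- The matrix coefficient `f ↦ ⟨f(M) x, y⟩` of the functional calculus of a normal operator. -/
noncomputable def cfcCoeffₗ (M : H →L[ℂ] H) (x y : H) : SmoothFunction →ₗ[ℂ] ℂ where
  toFun f := inner ℂ y (cfc (f : ℂ → ℂ) M x)
  map_add' f g := by
    have := cfc_add M (f : ℂ → ℂ) (g : ℂ → ℂ) f.coe_continuous.continuousOn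
      g.coe_continuous.continuousOn
    change inner ℂ y (cfc (fun z => f z + g z) M x) = _
    rw [this, add_apply, inner_add_right]
  map_smul' c f := by
    have := cfc_const_mul c (f : ℂ → ℂ) M f.coe_continuous.continuousOn
    change inner ℂ y (cfc (fun z => c * f z) M x) = _
    rw [this, smul_apply, inner_smul_right]
    rfl

theorem continuous_cfcCoeffₗ (M : H →L[ℂ] H) (x y : H) : Continuous (cfcCoeffₗ M x y) := by
  let K : TopologicalSpace.Compacts ℂ := ⟨spectrum ℂ M, spectrum.isCompact M⟩
  refine withSeminorms.continuous_normedSpace_rng ℂ _ ⟨{(0, K)}, ‖y‖₊ * ‖x‖₊, fun f => ?_⟩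
  rw [Finset.sup_singleton, Seminorm.comp_apply, smul_apply, NNReal.smul_def,
    smul_eq_mul, NNReal.coe_mul, coe_nnnorm, coe_nnnorm, coe_normSeminorm]
  calc ‖inner ℂ y (cfc (f : ℂ → ℂ) M x)‖ ≤ ‖y‖ * (‖cfc (f : ℂ → ℂ) M‖ * ‖x‖) :=
        (norm_inner_le_norm _ _).trans (by gcongr; exact ContinuousLinearMap.le_opNorm _ _)
    _ ≤ ‖y‖ * (smoothSeminorm (0, K) f * ‖x‖) := by
        gcongr
        exact norm_cfc_le (apply_nonneg _ _) fun z hz => f.norm_le_smoothSeminorm (K := K) hz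
    _ = ‖y‖ * ‖x‖ * smoothSeminorm (0, K) f := by ring

/-- The matrix coefficient `f ↦ ⟨f(M) x, y⟩` as a compactly supported distribution. -/
noncomputable def cfcCoeff (M : H →L[ℂ] H) (x y : H) : SmoothFunction →L[ℂ] ℂ :=
  ⟨cfcCoeffₗ M x y, continuous_cfcCoeffₗ M x y⟩

theorem cfcCoeff_apply (M : H →L[ℂ] H) (x y : H) (f : SmoothFunction) :
    cfcCoeff M x y f = inner ℂ y (cfc (f : ℂ → ℂ) M x) := rfl

theorem cfcCoeff_eq_zero (M : H →L[ℂ] H) (x y : H) {f : SmoothFunction}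
    (hf : (spectrum ℂ M).EqOn f 0) : cfcCoeff M x y f = 0 := by
  rw [cfcCoeff_apply, cfc_congr hf]
  simp [cfc_zero]

/-- Normality enters here: the calculus sends `z^k z̄^l` to `(M^l)* M^k`, and the adjoint moves to
the other side of the inner product. -/
theorem cfcCoeff_monomial (M : H →L[ℂ] H) (hM : IsStarNormal M) (x y : H) (k l : ℕ) :
    cfcCoeff M x y (monomial k l) = inner ℂ ((M ^ l) y) ((M ^ k) x) := by
  have e : cfc (monomial k l : ℂ → ℂ) M = star (M ^ l) * M ^ k := by
    have hc : ⇑(monomial k l) = fun z : ℂ => star (z ^ l) * z ^ k := by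
      rw [coe_monomial]
      funext z
      simp [mul_comm]
    rw [hc, cfc_mul (fun z : ℂ => star (z ^ l)) (fun z => z ^ k) M
      (by fun_prop) (by fun_prop), cfc_star, cfc_pow_id M l hM, cfc_pow_id M k hM]
  rw [cfcCoeff_apply, e, mul_apply_eq_comp, ContinuousLinearMap.star_eq_adjoint,
    ContinuousLinearMap.adjoint_inner_right]

/-- The distribution
`f ↦ ∑ i j, ⟨(∂ⁱ ∂̄ʲ f)(M) Nⁱ h, Nʲ h⟩ / (i! j!)` attached to a Jordan operator `M + N`
with `N ^ n = 0`. -/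
noncomputable def jordanDistribution (M N : H →L[ℂ] H) (h : H) (n : ℕ) : SmoothFunction →L[ℂ] ℂ :=
  ∑ j ∈ Finset.range n, ∑ i ∈ Finset.range n,
    ((j.factorial : ℂ)⁻¹ * (i.factorial : ℂ)⁻¹) •
      (cfcCoeff M ((N ^ i) h) ((N ^ j) h)).comp
        ((wirtinger (-Complex.I) ^ i).comp (wirtinger Complex.I ^ j))

theorem jordanDistribution_apply (M N : H →L[ℂ] H) (h : H) (n : ℕ) (f : SmoothFunction) :
    jordanDistribution M N h n f = ∑ j ∈ Finset.range n, ∑ i ∈ Finset.range n,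
      ((j.factorial : ℂ)⁻¹ * (i.factorial : ℂ)⁻¹) *
        cfcCoeff M ((N ^ i) h) ((N ^ j) h)
          ((wirtinger (-Complex.I) ^ i) ((wirtinger Complex.I ^ j) f)) := by
  simp [jordanDistribution]

theorem dsupport_jordanDistribution_subset (M N : H →L[ℂ] H) (h : H) (n : ℕ) :
    Distribution.dsupport (jordanDistribution M N h n) ⊆ spectrum ℂ M := by
  refine Set.sInter_subset_of_mem ⟨fun f hf => ?_, spectrum.isClosed M⟩
  rw [jordanDistribution_apply]
  refine Finset.sum_eq_zero fun j _ => Finset.sum_eq_zero fun i _ => ?_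
  rw [cfcCoeff_eq_zero, mul_zero]
  intro z hz
  -- Vanishing on the spectrum alone would not kill the derivatives; vanishing near each of its
  -- points does.
  have hz' : f =ᶠ[nhds z] 0 := notMem_tsupport_iff_eventuallyEq.1 fun hmem => hf hmem hz
  exact (wirtinger_pow_eventuallyEq_zero _ _ (wirtinger_pow_eventuallyEq_zero _ _ hz')).eq_of_nhds

/-- The index range must not depend on `k`, to match the fixed sum in `jordanDistribution`. Both
this sum and the binomial one extend to a common range: terms with `i ≥ n` die through `b ^ i`,
those with `i > k` through the binomial coefficient. -/
theorem Commute.add_pow_of_pow_eq_zero {R : Type*} [Semiring R] {a b : R} (hab : Commute a b)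
    {n : ℕ} (hb : b ^ n = 0) (k : ℕ) :
    (a + b) ^ k = ∑ i ∈ Finset.range n, k.choose i • (a ^ (k - i) * b ^ i) := by
  have hl : ∑ i ∈ Finset.range n, k.choose i • (a ^ (k - i) * b ^ i) =
      ∑ i ∈ Finset.range (max n (k + 1)), k.choose i • (a ^ (k - i) * b ^ i) :=
    Finset.sum_subset (Finset.range_mono (le_max_left _ _)) fun i _ hi => by
      rw [pow_eq_zero_of_le (not_lt.1 (Finset.mem_range.not.1 hi)) hb, mul_zero, smul_zero]
  have hr : ∑ i ∈ Finset.range (k + 1), k.choose i • (a ^ (k - i) * b ^ i) =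
      ∑ i ∈ Finset.range (max n (k + 1)), k.choose i • (a ^ (k - i) * b ^ i) :=
    Finset.sum_subset (Finset.range_mono (le_max_right _ _)) fun i _ hi => by
      rw [Nat.choose_eq_zero_of_lt (not_lt.1 (Finset.mem_range.not.1 hi)), zero_smul]
  rw [hl, ← hr, add_comm, hab.symm.add_pow]
  refine Finset.sum_congr rfl fun i _ => ?_
  rw [nsmul_eq_mul, Nat.cast_comm, (hab.pow_pow _ _).eq]

theorem inv_factorial_mul_descFactorial (k i : ℕ) :
    (i.factorial : ℂ)⁻¹ * (k.descFactorial i : ℂ) = k.choose i := by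
  rw [Nat.descFactorial_eq_factorial_mul_choose, Nat.cast_mul,
    inv_mul_cancel_left₀ (Nat.cast_ne_zero.2 i.factorial_ne_zero)]

theorem jordanDistribution_monomial {M N : H →L[ℂ] H} (hM : IsStarNormal M) (hMN : Commute M N)
    {n : ℕ} (hN : N ^ n = 0) (h : H) (k l : ℕ) :
    jordanDistribution M N h n (monomial k l) =
      inner ℂ (((M + N) ^ l) h) (((M + N) ^ k) h) := by
  rw [jordanDistribution_apply, hMN.add_pow_of_pow_eq_zero hN, hMN.add_pow_of_pow_eq_zero hN,
    sum_apply, sum_apply, sum_inner]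
  refine Finset.sum_congr rfl fun j _ => ?_
  rw [inner_sum]
  refine Finset.sum_congr rfl fun i _ => ?_
  rw [wirtinger_I_pow_monomial, map_smul, wirtinger_neg_I_pow_monomial, map_smul, map_smul,
    cfcCoeff_monomial M hM, smul_eq_mul, smul_eq_mul, ← Nat.cast_smul_eq_nsmul ℂ,
    ← Nat.cast_smul_eq_nsmul ℂ, smul_apply, smul_apply,
    inner_smul_left, inner_smul_right, map_natCast, ← inv_factorial_mul_descFactorial,
    ← inv_factorial_mul_descFactorial, mul_apply_eq_comp,
    mul_apply_eq_comp]
  ring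

/-- `polySmooth` as a linear map. -/
noncomputable def polySmoothₗ : MvPolynomial (Fin 2) ℂ →ₗ[ℂ] SmoothFunction where
  toFun := polySmooth
  map_add' p q := DFunLike.ext _ _ fun z => map_add (MvPolynomial.eval ![z, starRingEnd ℂ z]) p q
  map_smul' c p := DFunLike.ext _ _ fun z =>
    MvPolynomial.smul_eval ![z, starRingEnd ℂ z] p c

theorem MvPolynomial.monomial_one_fin_two {R : Type*} [CommSemiring R] (α : Fin 2 →₀ ℕ) :
    MvPolynomial.monomial α (1 : R) = MvPolynomial.X 0 ^ α 0 * MvPolynomial.X 1 ^ α 1 := by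
  rw [MvPolynomial.monomial_eq, map_one, one_mul, Finsupp.prod_fintype _ _ (by simp),
    Fin.prod_univ_two]

theorem aglerFunctional_eq_jordanDistribution {T M N : H →L[ℂ] H}
    (hT : IsJordanDecomposition T M N) {n : ℕ} (hN : N ^ n = 0) (h : H)
    (p : MvPolynomial (Fin 2) ℂ) :
    aglerFunctional T h p = jordanDistribution M N h n (polySmooth p) := by
  have e : aglerFunctional T h =
      (jordanDistribution M N h n : SmoothFunction →ₗ[ℂ] ℂ) ∘ₗ polySmoothₗ := by
    refine (MvPolynomial.basisMonomials (Fin 2) ℂ).ext fun α => ?_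
    rw [MvPolynomial.coe_basisMonomials]
    beta_reduce
    rw [MvPolynomial.monomial_one_fin_two,
      aglerFunctional_X_pow_mul, hT.eq_add]
    exact (jordanDistribution_monomial hT.normal hT.commute hN h _ _).symm
  rw [e]
  rfl

end Jordan

theorem mainTheorem9 {H : Type*} [NormedAddCommGroup H] [InnerProductSpace ℂ H]
    [CompleteSpace H] (T M N : H →L[ℂ] H) (hT : IsJordanDecomposition T M N) (h : H) :
    IsDistributionSupportedIn (aglerFunctional T h) (closedConvexHull ℝ (spectrum ℂ M)) := by
  obtain ⟨n, hN⟩ := hT.nilpotent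
  exact ⟨jordanDistribution M N h n, aglerFunctional_eq_jordanDistribution hT hN h,
    (dsupport_jordanDistribution_subset M N h n).trans subset_closedConvexHull⟩
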